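/- **Proposition 4.3 (Global Relations).** Identify $\mathbb{R}^4$ with $\mathbb{C}^2$ via $(x_1,x_2,x_3,x_4)\leftrightarrow(x_1+ix_2,\,x_3+ix_4)$, let $\omega=dx_1\wedge dx_2+dx_3\wedge dx_4$, and let $\Sigma$ be a closed (compact, connected, without boundary) smooth surface. Let $F=(A,B):\Sigma\to\mathbb{C}^2$ be a smooth immersion which is a Lagrangian self-shrinker, that is, $F^*\omega=0$ and $\vec H=-F^{\perp}$, where $\vec H$ is the mean curvature vector (the trace of the second fundamental form with respect to the induced metric) and $F^\perp$ is the component of the position vector normal to the surface. Suppose that the image $F(\Sigma)$ is symmetric with respect to the hyperplane $\{x_1=0\}$, i.e. it is invariant under the reflection $(x_1,x_2,x_3,x_4)\mapsto(-x_1,x_2,x_3,x_4)$. Then $|A|>0$ and $|B|>0$ everywhere on $\Sigma$. Moreover, there are constants $C_1,C_2>0$ such that $$r_1^4|\nabla\theta_1|^2=C_1e^{r_1^2},\qquad r_2^4|\nabla\theta_2|^2=C_2e^{r_2^2}$$ on all of $\Sigma$, where $A=r_1e^{i\theta_1}$ and $B=r_2e^{i\theta_2}$ are polar representations: $r_1=|A|$,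 $r_2=|B|$, the smooth functions $\theta_1,\theta_2$ exist near each point of $\Sigma$ and are locally unique up to adding constants in $2\pi\mathbb{Z}$, and $\nabla$ and $|\cdot|$ are taken with respect to the metric on $\Sigma$ induced by $F$. (Thus the constants do not depend on the point or on the local choice of $\theta_1,\theta_2$.) -/

import Mathlib

open scoped Manifold ContDiff Topology

namespace LagrangianShrinker

noncomputable section

/-- The parameter plane `ℝ²`, on which surfaces are modelled. -/
abbrev E2 : Type := EuclideanSpace ℝ (Fin 2)

/-- `ℝ⁴` with the Euclidean inner product; its coordinates `x₁, x₂, x₃, x₄` are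
`x 0, x 1, x 2, x 3`. -/
abbrev E4 : Type := EuclideanSpace ℝ (Fin 4)

/-- The standard basis of `ℝ²`. -/
def basisVec (i : Fin 2) : E2 := EuclideanSpace.single i 1

/-- The first component under the identification `ℝ⁴ ≃ ℂ²`,
`(x₁, x₂, x₃, x₄) ↔ (x₁ + i x₂, x₃ + i x₄)`. -/
def fstC (x : E4) : ℂ := ⟨x 0, x 1⟩

/-- The second component under the identification `ℝ⁴ ≃ ℂ²`. -/
def sndC (x : E4) : ℂ := ⟨x 2, x 3⟩

/-- The Kähler form `ω = dx₁ ∧ dx₂ + dx₃ ∧ dx₄`. -/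
def kahlerForm (v w : E4) : ℝ :=
  (v 0 * w 1 - v 1 * w 0) + (v 2 * w 3 - v 3 * w 2)

/-- The reflection of `ℝ⁴` in the hyperplane `{x₁ = 0}`. -/
def reflectX1 (x : E4) : E4 := !₂[-x 0, x 1, x 2, x 3]

/-! ### Parametrized surfaces `X : ℝ² → ℝ⁴` -/

/-- The component of `v` normal to the tangent plane `range (dX_x)`. -/
def normalPart (X : E2 → E4) (x : E2) (v : E4) : E4 :=
  (LinearMap.range (fderiv ℝ X x : E2 →ₗ[ℝ] E4))ᗮ.starProjection v

/-- The second fundamental form `II(v, w) = (D²X(v, w))^⊥`. -/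
def secondFundamentalForm (X : E2 → E4) (x v w : E2) : E4 :=
  normalPart X x (fderiv ℝ (fderiv ℝ X) x v w)

/-- The coefficients `g_ij = ⟨∂_i X, ∂_j X⟩` of the first fundamental form. -/
def firstFundamentalForm (X : E2 → E4) (x : E2) : Matrix (Fin 2) (Fin 2) ℝ :=
  Matrix.gram ℝ fun i => fderiv ℝ X x (basisVec i)

/-- The mean curvature vector: the trace `∑ g^{ij} II(∂_i, ∂_j)` of the second fundamental form
with respect to the first fundamental form. -/
def meanCurvatureVector (X : E2 → E4) (x : E2) : E4 :=
  ∑ i, ∑ j, (firstFundamentalForm X x)⁻¹ i j •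
    secondFundamentalForm X x (basisVec i) (basisVec j)

/-! ### Immersed surfaces `F : M → ℝ⁴` -/

variable {M : Type*} [TopologicalSpace M] [ChartedSpace E2 M]

/-- The differential of `F : M → ℝ⁴` at `p`. (In Mathlib the tangent space of `M` at `p` is
the model space `E2`, and the tangent space of `E4` at any point is `E4`.) -/
def differential (F : M → E4) (p : M) : E2 →L[ℝ] E4 :=
  mfderiv 𝓘(ℝ, E2) 𝓘(ℝ, E4) F p

/-- The differential of a real function on `M` at `p`. -/
def scalarDifferential (u : M → ℝ) (p : M) : E2 →L[ℝ] ℝ :=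
  mfderiv 𝓘(ℝ, E2) 𝓘(ℝ, ℝ) u p

/-- The induced metric `g_p(v, w) = ⟨dF_p v, dF_p w⟩`. -/
def inducedMetric (F : M → E4) (p : M) (v w : E2) : ℝ :=
  inner ℝ (differential F p v) (differential F p w)

/-- The gradient `∇u = ∑ g^{ij} ∂_j u ∂_i` of `u` at `p` with respect to the induced metric. -/
def gradient (F : M → E4) (u : M → ℝ) (p : M) : E2 :=
  ∑ i, (∑ j, (Matrix.gram ℝ fun k => differential F p (basisVec k))⁻¹ i j *
    scalarDifferential u p (basisVec j)) • basisVec i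

/-- The squared length `|∇u|² = g_p(∇u, ∇u)`. -/
def gradNormSq (F : M → E4) (u : M → ℝ) (p : M) : ℝ :=
  inducedMetric F p (gradient F u p) (gradient F u p)

/-- Sanity check: where `F` is an immersion, `gradient` is the metric dual of `du`. -/
theorem inducedMetric_gradient (F : M → E4) (u : M → ℝ) (p : M)
    (hF : Function.Injective (differential F p)) (v : E2) :
    inducedMetric F p (gradient F u p) v = scalarDifferential u p v := by
  have hli : LinearIndependent ℝ fun k => differential F p (basisVec k) := by
    have h0 : LinearIndependent ℝ (basisVec : Fin 2 → E2) := by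
      have h1 := (EuclideanSpace.basisFun (Fin 2) ℝ).toBasis.linearIndependent
      have h2 : (basisVec : Fin 2 → E2) = (EuclideanSpace.basisFun (Fin 2) ℝ).toBasis := by
        ext i : 1
        simp [basisVec]
      rw [h2]
      exact h1
    exact h0.map' (differential F p : E2 →ₗ[ℝ] E4) (LinearMap.ker_eq_bot.2 hF)
  have hpd := Matrix.posDef_gram_of_linearIndependent hli
  set G := Matrix.gram ℝ fun k => differential F p (basisVec k) with hG
  have hdet : IsUnit G.det := (Matrix.isUnit_iff_isUnit_det _).1 hpd.isUnit
  have hv : v = ∑ k, v k • basisVec k := by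
    ext i
    fin_cases i <;> simp [basisVec]
  have hsymm : ∀ i j, G i j = G j i := fun i j => by
    simp [hG, Matrix.gram_apply, real_inner_comm]
  have key : ∀ k, inducedMetric F p (gradient F u p) (basisVec k) =
      scalarDifferential u p (basisVec k) := by
    intro k
    have h1 : inducedMetric F p (gradient F u p) (basisVec k) =
        (G.mulVec (G⁻¹.mulVec fun j => scalarDifferential u p (basisVec j))) k := by
      simp only [inducedMetric, gradient, map_sum, map_smul, sum_inner, real_inner_smul_left,
        Matrix.mulVec, dotProduct, ← hG]
      refine Finset.sum_congr rfl fun i _ => ?_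
      rw [hsymm k i, mul_comm]
      rfl
    rw [h1, Matrix.mulVec_mulVec, Matrix.mul_nonsing_inv _ hdet, Matrix.one_mulVec]
  rw [hv, map_sum]
  simp only [map_smul, ← key, inducedMetric, map_sum, inner_sum, real_inner_smul_right,
    smul_eq_mul]

/-- `F` is a smooth immersion. -/
def IsSmoothImmersion (F : M → E4) : Prop :=
  ContMDiff 𝓘(ℝ, E2) 𝓘(ℝ, E4) ∞ F ∧ ∀ p, Function.Injective (differential F p)

/-- The Lagrangian condition `F^* ω = 0`. -/
def IsLagrangian (F : M → E4) : Prop :=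
  ∀ p v w, kahlerForm (differential F p v) (differential F p w) = 0

/-- The self-shrinker equation `H = -F^⊥`, written in the local parametrizations `F ∘ φ⁻¹` given
by the charts `φ` of `M`. Neither side depends on the chart. -/
def SatisfiesShrinkerEquation (F : M → E4) : Prop :=
  ∀ φ ∈ atlas E2 M, ∀ x ∈ φ.target,
    meanCurvatureVector (F ∘ φ.symm) x = -normalPart (F ∘ φ.symm) x (F (φ.symm x))

/-- `F` is a Lagrangian self-shrinker. -/
structure IsLagrangianSelfShrinker (F : M → E4) : Prop where
  immersion : IsSmoothImmersion F
  lagrangian : IsLagrangian F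
  shrinker : SatisfiesShrinkerEquation F

/-- The surface `F(M)` is symmetric with respect to the hyperplane `{x₁ = 0}`. -/
def IsSymmetricX1 (F : M → E4) : Prop :=
  reflectX1 '' Set.range F = Set.range F

/-- `f = |f| e^{iθ}` near `p`, with a smooth angle function `θ`: a local polar representation
of the complex function `f`. -/
def IsPolarAngleNear (f : M → ℂ) (θ : M → ℝ) (p : M) : Prop :=
  ContMDiffAt 𝓘(ℝ, E2) 𝓘(ℝ, ℝ) ∞ θ p ∧
    ∀ᶠ q in 𝓝 p, f q = (‖f q‖ : ℂ) * Complex.exp ((θ q : ℂ) * Complex.I)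

/-- The relation `r⁴ |∇θ|² = C e^{r²}` on all of `M`, where `f = r e^{iθ}`: a local polar
representation exists near every point, and every local polar representation satisfies the
relation. -/
def PolarRelation (F : M → E4) (f : M → ℂ) (C : ℝ) : Prop :=
  ∀ p, (∃ θ, IsPolarAngleNear f θ p) ∧
    ∀ θ, IsPolarAngleNear f θ p →
      ‖f p‖ ^ 4 * gradNormSq F θ p = C * Real.exp (‖f p‖ ^ 2)

end

end LagrangianShrinker

/-! The symmetry forces the surface to split locally into two plane curves. Write R for the
reflection. R maps F(M) to itself, so on a dense open set R carries tangent planes of F(M) to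
tangent planes, which are Lagrangian. There ω vanishes on dF and on R∘dF. Since R reverses dx₁∧dx₂
and fixes dx₃∧dx₄, both A^*(dx₁∧dx₂) and B^*(dx₃∧dx₄) vanish, first on the dense set and then
everywhere by continuity (`cross_eq_zero_of_symmetric`).

As dF is injective, dA and dB then have rank exactly one, and every tangent plane is a line in ℂ ⊕ 0
plus a line in 0 ⊕ ℂ. Pairing H = -F^⊥ with the normal (iT, 0), where T = dA(e) and dB(e) = 0, gives
the planar self-shrinking curve equation for A (`cross_secondDeriv_of_shrinker`). It has the first
integral (A × T)² |T|⁻² e^{-|A|²}, which is therefore a constant C on the connected surface.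

At a maximum of |A| the vectors A and T are orthogonal, so C ≤ 0 would make A vanish identically,
contradicting T ≠ 0. Hence C > 0, so A × T and A never vanish. Finally A × dA = r₁² dθ₁ turns the
first integral into r₁⁴|∇θ₁|² = C e^{r₁²}. The same argument with the factors exchanged treats B. -/

namespace LagrangianShrinker

noncomputable section

/-! ### Linear algebra of an orthogonal splitting `ℝ⁴ = ℂ ⊕ ℂ` -/

/-- The real inner product of `ℂ = ℝ²`. -/
def dot (z w : ℂ) : ℝ := z.re * w.re + z.im * w.im

/-- The area form of `ℂ = ℝ²`. -/
def cross (z w : ℂ) : ℝ := z.re * w.im - z.im * w.re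

theorem dot_self (z : ℂ) : dot z z = Complex.normSq z := rfl

/-- Two maps `a, b : ℝ⁴ → ℂ` which are the coordinates of an orthogonal splitting. -/
structure IsSplitting (a b : E4 →L[ℝ] ℂ) : Prop where
  inner_eq : ∀ x y, inner ℝ x y = dot (a x) (a y) + dot (b x) (b y)
  lift : ∀ z, ∃ x, a x = z ∧ b x = 0

/-- `fstC` as a continuous linear map. -/
def fstL : E4 →L[ℝ] ℂ :=
  LinearMap.toContinuousLinearMap
    { toFun := fstC
      map_add' := fun x y => by simp [fstC, Complex.ext_iff]
      map_smul' := fun c x => by simp [fstC, Complex.ext_iff] }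

/-- `sndC` as a continuous linear map. -/
def sndL : E4 →L[ℝ] ℂ :=
  LinearMap.toContinuousLinearMap
    { toFun := sndC
      map_add' := fun x y => by simp [sndC, Complex.ext_iff]
      map_smul' := fun c x => by simp [sndC, Complex.ext_iff] }

theorem fstL_apply (x : E4) : fstL x = fstC x := rfl

theorem sndL_apply (x : E4) : sndL x = sndC x := rfl

theorem isSplitting_fstL_sndL : IsSplitting fstL sndL where
  inner_eq x y := by
    simp [fstL_apply, sndL_apply, fstC, sndC, dot, PiLp.inner_apply, Fin.sum_univ_four]
    ring
  lift z := ⟨!₂[z.re, z.im, 0, 0], by simp [fstL_apply, sndL_apply, fstC, sndC, Complex.ext_iff]⟩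

theorem isSplitting_sndL_fstL : IsSplitting sndL fstL where
  inner_eq x y := by rw [isSplitting_fstL_sndL.inner_eq, add_comm]
  lift z := ⟨!₂[0, 0, z.re, z.im], by simp [fstL_apply, sndL_apply, fstC, sndC, Complex.ext_iff]⟩

theorem kahlerForm_eq (v w : E4) :
    kahlerForm v w = cross (fstL v) (fstL w) + cross (sndL v) (sndL w) := rfl

theorem eq_smul_of_cross_eq_zero {t z : ℂ} (ht : t ≠ 0) (h : cross z t = 0) :
    z = (dot t z / Complex.normSq t) • t := by
  have hn : Complex.normSq t ≠ 0 := by simpa using ht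
  have hn' : t.re * t.re + t.im * t.im ≠ 0 := hn
  unfold cross at h
  apply Complex.ext <;> simp only [Complex.real_smul, Complex.re_ofReal_mul,
    Complex.im_ofReal_mul, dot, Complex.normSq_apply] <;> rw [div_mul_eq_mul_div, eq_div_iff hn']
  · linear_combination t.im * h
  · linear_combination -t.re * h

theorem cross_eq_dot_I_mul (z w : ℂ) : cross z w = dot w (Complex.I * z) := by
  simp [cross, dot]; ring

theorem cross_comm (z w : ℂ) : cross z w = -cross w z := by simp only [cross]; ring

theorem cross_smul_left (c : ℝ) (z w : ℂ) : cross (c • z) w = c * cross z w := by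
  simp [cross]; ring

theorem cross_smul_right (c : ℝ) (z w : ℂ) : cross z (c • w) = c * cross z w := by
  simp [cross]; ring

theorem dot_smul_right (c : ℝ) (z w : ℂ) : dot z (c • w) = c * dot z w := by
  simp [dot]; ring

/-- A real linear map `ℝ² → ℂ` whose image is isotropic has a kernel. -/
theorem exists_ne_zero_of_cross_eq_zero (L : E2 →L[ℝ] ℂ) (h : ∀ v w, cross (L v) (L w) = 0) :
    ∃ e, e ≠ 0 ∧ L e = 0 := by
  by_contra! hc
  have hinj : Function.Injective (L : E2 →ₗ[ℝ] ℂ) :=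
    (injective_iff_map_eq_zero _).2 fun v hv => by_contra fun hv' => hc v hv' hv
  have hsurj : Function.Surjective (L : E2 →ₗ[ℝ] ℂ) :=
    (LinearMap.injective_iff_surjective_of_finrank_eq_finrank
      (by simp [Complex.finrank_real_complex])).1 hinj
  obtain ⟨v, hv⟩ := hsurj 1
  obtain ⟨w, hw⟩ := hsurj Complex.I
  have hvw := h v w
  rw [show L v = 1 from hv, show L w = Complex.I from hw] at hvw
  simp [cross] at hvw

/-- Isotropy makes `b ∘ L` singular; on its kernel `a` carries the whole length of `L e`. Such an
`e` is a tangent direction lying purely in the `a` factor. -/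
theorem IsSplitting.exists_kernel_vector {a b : E4 →L[ℝ] ℂ} (hs : IsSplitting a b)
    {L : E2 →L[ℝ] E4} (hL : Function.Injective L)
    (h : ∀ v w, cross (b (L v)) (b (L w)) = 0) : ∃ e, b (L e) = 0 ∧ a (L e) ≠ 0 := by
  obtain ⟨e, he, hbe⟩ := exists_ne_zero_of_cross_eq_zero (b ∘L L) h
  replace hbe : b (L e) = 0 := hbe
  refine ⟨e, hbe, fun hae => he (hL ?_)⟩
  rw [map_zero, ← inner_self_eq_zero (𝕜 := ℝ), hs.inner_eq, hae, hbe]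
  simp [dot]

theorem sum_smul_basisVec (v : E2) : ∑ k, v k • basisVec k = v := by
  ext i
  fin_cases i <;> simp [basisVec]

theorem linearIndependent_basisVec : LinearIndependent ℝ basisVec := by
  have h := (EuclideanSpace.basisFun (Fin 2) ℝ).toBasis.linearIndependent
  have h2 : (basisVec : Fin 2 → E2) = (EuclideanSpace.basisFun (Fin 2) ℝ).toBasis := by
    ext i : 1
    simp [basisVec]
  rwa [h2]

/-- The trace with respect to the first fundamental form of `⟨L e, L ·⟩²` is `|L e|²`. -/
theorem sum_gram_inv_mul_inner_mul_inner {L : E2 →L[ℝ] E4} (hL : Function.Injective L) (e : E2) :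
    ∑ i, ∑ j, (Matrix.gram ℝ fun k => L (basisVec k))⁻¹ i j *
      (inner ℝ (L e) (L (basisVec i)) * inner ℝ (L e) (L (basisVec j))) =
      inner ℝ (L e) (L e) := by
  have hli : LinearIndependent ℝ fun k => L (basisVec k) :=
    linearIndependent_basisVec.map' (L : E2 →ₗ[ℝ] E4) (LinearMap.ker_eq_bot.2 hL)
  set G := Matrix.gram ℝ fun k => L (basisVec k) with hG
  have hdet : IsUnit G.det :=
    (Matrix.isUnit_iff_isUnit_det _).1 (Matrix.posDef_gram_of_linearIndependent hli).isUnit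
  have hLe : L e = ∑ k, e k • L (basisVec k) := by
    conv_lhs => rw [← sum_smul_basisVec e, map_sum]
    simp
  have hu : ∀ i, inner ℝ (L e) (L (basisVec i)) = G.mulVec (fun k => e k) i := fun i => by
    conv_lhs => rw [hLe]
    simp only [sum_inner, real_inner_smul_left, Matrix.mulVec, dotProduct, hG, Matrix.gram_apply]
    exact Finset.sum_congr rfl fun k _ => by rw [real_inner_comm, mul_comm]
  have h1 : ∀ i, ∑ j, G⁻¹ i j * G.mulVec (fun k => e k) j = e i := fun i => by
    change G⁻¹.mulVec (G.mulVec fun k => e k) i = e i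
    rw [Matrix.mulVec_mulVec, Matrix.nonsing_inv_mul _ hdet, Matrix.one_mulVec]
  calc _ = ∑ i, inner ℝ (L e) (L (basisVec i)) * e i := by
        refine Finset.sum_congr rfl fun i _ => ?_
        rw [← h1 i, Finset.mul_sum]
        refine Finset.sum_congr rfl fun j _ => ?_
        rw [hu j]; ring
    _ = inner ℝ (L e) (L e) := by
        conv_rhs => rw [hLe, inner_sum]
        simp only [real_inner_smul_right, ← hLe]
        exact Finset.sum_congr rfl fun i _ => mul_comm _ _

/-- For a map `L : ℝ² → ℂ` of rank one, the number `q` with `(z × L v)² = q |L v|²`. -/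
def crossQuotient (z : ℂ) (L : E2 →L[ℝ] ℂ) : ℝ :=
  (∑ i, cross z (L (basisVec i)) ^ 2) / ∑ i, Complex.normSq (L (basisVec i))

/-- All values of `L` are multiples of `L e`, so the squared coefficients cancel. Any vector outside
the kernel computes the quotient. -/
theorem crossQuotient_eq (z : ℂ) {L : E2 →L[ℝ] ℂ} (h : ∀ v w, cross (L v) (L w) = 0) {e : E2}
    (he : L e ≠ 0) : crossQuotient z L = cross z (L e) ^ 2 / Complex.normSq (L e) := by
  have hn : Complex.normSq (L e) ≠ 0 := by simpa using he
  choose c hc using fun i => (⟨_, eq_smul_of_cross_eq_zero he (h (basisVec i) e)⟩ :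
    ∃ c : ℝ, L (basisVec i) = c • L e)
  have hsum : ∑ i, c i ^ 2 ≠ 0 := by
    intro h0
    have hci : ∀ i, c i = 0 := fun i => by
      simpa using (Finset.sum_eq_zero_iff_of_nonneg fun i _ => sq_nonneg (c i)).1 h0 i
    apply he
    rw [← sum_smul_basisVec e, map_sum]
    simp [hc, hci]
  have h1 : ∑ i, cross z (L (basisVec i)) ^ 2 = (∑ i, c i ^ 2) * cross z (L e) ^ 2 := by
    rw [Finset.sum_mul]
    exact Finset.sum_congr rfl fun i _ => by rw [hc i, cross_smul_right, mul_pow]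
  have h2 : ∑ i, Complex.normSq (L (basisVec i)) = (∑ i, c i ^ 2) * Complex.normSq (L e) := by
    rw [Finset.sum_mul]
    exact Finset.sum_congr rfl fun i _ => by
      rw [hc i, Complex.real_smul, map_mul, Complex.normSq_ofReal, sq]
  rw [crossQuotient, h1, h2, mul_div_mul_left _ _ hsum]

/-- The quotient depends only on the line `range L`; this makes the first integral independent of
the chart. -/
theorem crossQuotient_comp (z : ℂ) {L : E2 →L[ℝ] ℂ} (h : ∀ v w, cross (L v) (L w) = 0)
    (hL : ∃ e, L e ≠ 0) {N : E2 →L[ℝ] E2} (hN : Function.Surjective N) :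
    crossQuotient z (L ∘L N) = crossQuotient z L := by
  obtain ⟨e, he⟩ := hL
  obtain ⟨e, rfl⟩ := hN e
  rw [crossQuotient_eq z h he]
  exact crossQuotient_eq z (L := L ∘L N) (fun v w => h _ _) he

theorem normSq_mul_normSq (z w : ℂ) :
    Complex.normSq z * Complex.normSq w = dot z w ^ 2 + cross z w ^ 2 := by
  simp only [Complex.normSq_apply, dot, cross]; ring

theorem fderiv_normSq_comp {f : E2 → ℂ} {x : E2} (hf : DifferentiableAt ℝ f x) (v : E2) :
    fderiv ℝ (fun y => Complex.normSq (f y)) x v = 2 * dot (f x) (fderiv ℝ f x v) := by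
  have hre := Complex.reCLM.hasFDerivAt.comp x hf.hasFDerivAt
  have him := Complex.imCLM.hasFDerivAt.comp x hf.hasFDerivAt
  have h := (hre.mul hre).add (him.mul him)
  rw [HasFDerivAt.fderiv (f := fun y => Complex.normSq (f y)) h]
  simp [dot]; ring

theorem fderiv_cross {f g : E2 → ℂ} {x : E2} {f' g' : E2 →L[ℝ] ℂ} (hf : HasFDerivAt f f' x)
    (hg : HasFDerivAt g g' x) (v : E2) :
    fderiv ℝ (fun y => cross (f y) (g y)) x v = cross (f' v) (g x) + cross (f x) (g' v) := by
  have hfr := Complex.reCLM.hasFDerivAt.comp x hf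
  have hfi := Complex.imCLM.hasFDerivAt.comp x hf
  have hgr := Complex.reCLM.hasFDerivAt.comp x hg
  have hgi := Complex.imCLM.hasFDerivAt.comp x hg
  have h := (hfr.mul hgi).sub (hfi.mul hgr)
  rw [HasFDerivAt.fderiv (f := fun y => cross (f y) (g y)) h]
  simp [cross]; ring

/-! ### Local computations for a parametrized surface -/

theorem inner_normalPart {X : E2 → E4} {x : E2} {n : E4}
    (hn : ∀ v, inner ℝ (fderiv ℝ X x v) n = 0) (u : E4) :
    inner ℝ (normalPart X x u) n = inner ℝ u n := by
  have hmem : n ∈ (LinearMap.range (fderiv ℝ X x : E2 →ₗ[ℝ] E4))ᗮ := by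
    rw [Submodule.mem_orthogonal]
    rintro _ ⟨v, rfl⟩
    exact hn v
  rw [normalPart, Submodule.inner_starProjection_left_eq_right,
    Submodule.starProjection_eq_self_iff.2 hmem]

section

variable {a b : E4 →L[ℝ] ℂ} {X : E2 → E4} {x : E2}

theorem hasFDerivAt_clm_fderiv_apply (hX : ContDiffAt ℝ ∞ X x) (v : E2) :
    HasFDerivAt (fun y => a (fderiv ℝ X y v)) (a ∘L (fderiv ℝ (fderiv ℝ X) x).flip v) x := by
  have h1 : HasFDerivAt (fderiv ℝ X) (fderiv ℝ (fderiv ℝ X) x) x :=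
    ((hX.fderiv_right (m := 1) (by norm_cast)).differentiableAt (by simp)).hasFDerivAt
  have h2 : HasFDerivAt (fun y => fderiv ℝ X y v) ((fderiv ℝ (fderiv ℝ X) x).flip v) x := by
    simpa using h1.clm_apply (hasFDerivAt_const v x)
  exact a.hasFDerivAt.comp x h2

theorem cross_fderiv_fderiv (hX : ContDiffAt ℝ ∞ X x)
    (h : ∀ᶠ y in 𝓝 x, ∀ v w, cross (a (fderiv ℝ X y v)) (a (fderiv ℝ X y w)) = 0) (u v w : E2) :
    cross (a (fderiv ℝ (fderiv ℝ X) x u v)) (a (fderiv ℝ X x w)) +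
      cross (a (fderiv ℝ X x v)) (a (fderiv ℝ (fderiv ℝ X) x u w)) = 0 := by
  have h1 := fderiv_cross (hasFDerivAt_clm_fderiv_apply (a := a) hX v)
    (hasFDerivAt_clm_fderiv_apply (a := a) hX w) u
  have h2 : (fun y => cross (a (fderiv ℝ X y v)) (a (fderiv ℝ X y w))) =ᶠ[𝓝 x] fun _ => 0 := by
    filter_upwards [h] with y hy using hy v w
  rw [h2.fderiv_eq] at h1
  simpa using h1.symm

theorem secondDeriv_symm (hX : ContDiffAt ℝ ∞ X x) (v w : E2) :
    fderiv ℝ (fderiv ℝ X) x v w = fderiv ℝ (fderiv ℝ X) x w v :=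
  hX.isSymmSndFDerivAt (by simp; norm_cast) v w

/-- The pairing of the second derivative with the normal direction of the curve factor. -/
theorem cross_secondDeriv (hX : ContDiffAt ℝ ∞ X x)
    (h : ∀ᶠ y in 𝓝 x, ∀ v w, cross (a (fderiv ℝ X y v)) (a (fderiv ℝ X y w)) = 0)
    {e v : E2} {c : ℝ} (hv : a (fderiv ℝ X x v) = c • a (fderiv ℝ X x e)) (w : E2) :
    cross (a (fderiv ℝ X x e)) (a (fderiv ℝ (fderiv ℝ X) x v w)) =
      c * cross (a (fderiv ℝ X x e)) (a (fderiv ℝ (fderiv ℝ X) x e w)) := by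
  -- Differentiate the isotropy of the pair `v`, `e` in the direction `w`; symmetry of the second
  -- derivative does the rest.
  have h1 := cross_fderiv_fderiv hX h w v e
  rw [hv, cross_smul_left, secondDeriv_symm hX w v, secondDeriv_symm hX w e,
    cross_comm (a (fderiv ℝ (fderiv ℝ X) x v w))] at h1
  linarith

/-- The equation of a self-shrinking curve, satisfied by each factor of the surface. -/
theorem cross_secondDeriv_of_shrinker (hs : IsSplitting a b) (hX : ContDiffAt ℝ ∞ X x)
    (hinj : Function.Injective (fderiv ℝ X x))
    (h : ∀ᶠ y in 𝓝 x, ∀ v w, cross (a (fderiv ℝ X y v)) (a (fderiv ℝ X y w)) = 0)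
    (hH : meanCurvatureVector X x = -normalPart X x (X x)) {e : E2}
    (hbe : b (fderiv ℝ X x e) = 0) (hae : a (fderiv ℝ X x e) ≠ 0) :
    cross (a (fderiv ℝ X x e)) (a (fderiv ℝ (fderiv ℝ X) x e e)) =
      cross (a (X x)) (a (fderiv ℝ X x e)) * Complex.normSq (a (fderiv ℝ X x e)) := by
  have hx := h.self_of_nhds
  set L := fderiv ℝ X x with hL
  set N := Complex.normSq (a (L e)) with hN
  have hN0 : N ≠ 0 := by simpa [hN] using hae
  set K := cross (a (L e)) (a (fderiv ℝ (fderiv ℝ X) x e e)) with hK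
  -- `n` is the tangent of the curve factor rotated by a quarter turn, with zero `b` component. It
  -- is normal because every `a (L v)` is parallel to `a (L e)`.
  obtain ⟨n, han, hbn⟩ := hs.lift (Complex.I * a (L e))
  have hpair : ∀ u, inner ℝ u n = cross (a (L e)) (a u) := fun u => by
    rw [hs.inner_eq, han, hbn, cross_eq_dot_I_mul]; simp [dot]
  have hn : ∀ v, inner ℝ (L v) n = 0 := fun v => by rw [hpair, hx e v]
  have hin : ∀ v, inner ℝ (L e) (L v) = dot (a (L e)) (a (L v)) := fun v => by
    rw [hs.inner_eq, hbe]; simp [dot]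
  -- Using `cross_secondDeriv` in each argument, the form has rank one: only the curvature `K` of
  -- the curve factor survives.
  have hII : ∀ v w, inner ℝ (secondFundamentalForm X x v w) n =
      K / N ^ 2 * (inner ℝ (L e) (L v) * inner ℝ (L e) (L w)) := fun v w => by
    rw [secondFundamentalForm, inner_normalPart hn, hpair,
      cross_secondDeriv hX h (eq_smul_of_cross_eq_zero hae (hx v e)) w, secondDeriv_symm hX e w,
      cross_secondDeriv hX h (eq_smul_of_cross_eq_zero hae (hx w e)) e, hin, hin, ← hL, ← hK,
      ← hN]
    field_simp
  have hlhs : inner ℝ (meanCurvatureVector X x) n = K / N := by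
    have h1 : inner ℝ (meanCurvatureVector X x) n = K / N ^ 2 * ∑ i, ∑ j,
        (firstFundamentalForm X x)⁻¹ i j *
          (inner ℝ (L e) (L (basisVec i)) * inner ℝ (L e) (L (basisVec j))) := by
      simp only [meanCurvatureVector, sum_inner, real_inner_smul_left, hII, Finset.mul_sum]
      exact Finset.sum_congr rfl fun i _ => Finset.sum_congr rfl fun j _ => by ring
    rw [h1, firstFundamentalForm, sum_gram_inv_mul_inner_mul_inner hinj, hin, dot_self, ← hN]
    field_simp
  have hrhs : inner ℝ (-normalPart X x (X x)) n = cross (a (X x)) (a (L e)) := by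
    rw [inner_neg_left, inner_normalPart hn, hpair, ← cross_comm]
  rw [hH, hrhs] at hlhs
  rw [hlhs]
  field_simp

theorem cross_mul_normSq (z t w : ℂ) :
    cross z w * Complex.normSq t = cross z t * dot t w + dot z t * cross t w := by
  simp only [Complex.normSq_apply, dot, cross]; ring

/-- The first integral of the self-shrinking curve, as a function on the surface. -/
theorem hasFDerivAt_firstIntegral (hs : IsSplitting a b) (hX : ContDiffAt ℝ ∞ X x)
    (hinj : Function.Injective (fderiv ℝ X x))
    (ha : ∀ᶠ y in 𝓝 x, ∀ v w, cross (a (fderiv ℝ X y v)) (a (fderiv ℝ X y w)) = 0)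
    (hb : ∀ v w, cross (b (fderiv ℝ X x v)) (b (fderiv ℝ X x w)) = 0)
    (hH : meanCurvatureVector X x = -normalPart X x (X x)) :
    HasFDerivAt (fun y => crossQuotient (a (X y)) (a ∘L fderiv ℝ X y) *
      Real.exp (-Complex.normSq (a (X y)))) (0 : E2 →L[ℝ] ℝ) x := by
  -- `e` stays a constant vector while the base point varies. It need lie in the kernel of the `b`
  -- part only at `x`; nearby, `a (fderiv ℝ X y e) ≠ 0` suffices to compute the quotient.
  obtain ⟨e, hbe, hae⟩ := hs.exists_kernel_vector hinj hb
  have hcurv := cross_secondDeriv_of_shrinker hs hX hinj ha hH hbe hae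
  have hT := hasFDerivAt_clm_fderiv_apply (a := a) hX e
  have hZ : HasFDerivAt (fun y => a (X y)) (a ∘L fderiv ℝ X x) x :=
    a.hasFDerivAt.comp x (hX.differentiableAt (by simp)).hasFDerivAt
  have hcross_diff : DifferentiableAt ℝ (fun y => cross (a (X y)) (a (fderiv ℝ X y e))) x := by
    have hzr := (Complex.reCLM.hasFDerivAt.comp x hZ).differentiableAt
    have hzi := (Complex.imCLM.hasFDerivAt.comp x hZ).differentiableAt
    have htr := (Complex.reCLM.hasFDerivAt.comp x hT).differentiableAt
    have hti := (Complex.imCLM.hasFDerivAt.comp x hT).differentiableAt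
    exact (hzr.mul hti).sub (hzi.mul htr)
  have hnormSq_diff : ∀ {f : E2 → ℂ}, DifferentiableAt ℝ f x →
      DifferentiableAt ℝ (fun y => Complex.normSq (f y)) x := fun {f} hf => by
    have hr := (Complex.reCLM.hasFDerivAt.comp x hf.hasFDerivAt).differentiableAt
    have hi := (Complex.imCLM.hasFDerivAt.comp x hf.hasFDerivAt).differentiableAt
    exact (hr.mul hr).add (hi.mul hi)
  have hN0 : Complex.normSq (a (fderiv ℝ X x e)) ≠ 0 := by simpa using hae
  have hu := hcross_diff.hasFDerivAt
  have hn := (hnormSq_diff hT.differentiableAt).hasFDerivAt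
  have hr := (hnormSq_diff hZ.differentiableAt).hasFDerivAt
  have hψ := ((hu.pow 2).mul ((hasDerivAt_inv hN0).comp_hasFDerivAt x hn)).mul hr.neg.exp
  have heq : (fun y => crossQuotient (a (X y)) (a ∘L fderiv ℝ X y) *
      Real.exp (-Complex.normSq (a (X y)))) =ᶠ[𝓝 x] fun y =>
      cross (a (X y)) (a (fderiv ℝ X y e)) ^ 2 / Complex.normSq (a (fderiv ℝ X y e)) *
      Real.exp (-Complex.normSq (a (X y))) := by
    filter_upwards [ha, hT.continuousAt.eventually_ne hae] with y hy hy0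
    rw [crossQuotient_eq _ (L := a ∘L fderiv ℝ X y) hy hy0]
    rfl
  refine (HasFDerivAt.congr_of_eventuallyEq (hψ.congr_fderiv ?_) heq)
  ext v
  have hv := eq_smul_of_cross_eq_zero hae (ha.self_of_nhds v e)
  set c := dot (a (fderiv ℝ X x e)) (a (fderiv ℝ X x v)) / Complex.normSq (a (fderiv ℝ X x e))
  have hev := cross_secondDeriv hX ha hv e
  rw [hcurv] at hev
  have h1 := fderiv_cross hZ hT v
  have h2 := fderiv_normSq_comp hT.differentiableAt v
  have h3 := fderiv_normSq_comp hZ.differentiableAt v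
  -- Expanding the derivative of T in the frame T, iT: its tangential part cancels against the
  -- derivative of |T|², and its normal part, given by the curve equation, against that of the
  -- exponential.
  have h4 := cross_mul_normSq (a (X x)) (a (fderiv ℝ X x e)) (a (fderiv ℝ (fderiv ℝ X) x v e))
  rw [hT.fderiv] at h2
  rw [hZ.fderiv] at h3
  simp only [ContinuousLinearMap.comp_apply, ContinuousLinearMap.flip_apply, hv] at h1 h2 h3
  rw [cross_smul_left, cross_comm _ (a (fderiv ℝ X x e)),
    show cross (a (fderiv ℝ X x e)) (a (fderiv ℝ X x e)) = 0 by simp [cross]; ring] at h1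
  rw [dot_smul_right] at h3
  rw [hev] at h4
  simp [h1, h2, h3]
  field_simp
  linear_combination (cross (a (X x)) (a (fderiv ℝ X x e)) *
    Real.exp (-Complex.normSq (a (X x))) * 2) * h4

end

/-! ### Passing to charts -/

section

variable {M : Type*} [TopologicalSpace M] [ChartedSpace E2 M]

theorem IsSmoothImmersion.mdifferentiableAt {F : M → E4} (hF : IsSmoothImmersion F) (p : M) :
    MDifferentiableAt 𝓘(ℝ, E2) 𝓘(ℝ, E4) F p :=
  hF.1.mdifferentiableAt (by simp)

theorem differential_clm_comp (A : E4 →L[ℝ] E4) {F : M → E4} {p : M}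
    (hF : MDifferentiableAt 𝓘(ℝ, E2) 𝓘(ℝ, E4) F p) :
    differential (fun q => A (F q)) p = A ∘L differential F p := by
  have h := mfderiv_comp p (g := A) (I' := 𝓘(ℝ, E4)) (I'' := 𝓘(ℝ, E4))
    A.differentiableAt.mdifferentiableAt hF
  rw [mfderiv_eq_fderiv, A.fderiv] at h
  exact h

variable [IsManifold 𝓘(ℝ, E2) ∞ M]

/-- The derivative of the inverse chart centred at `p`. -/
def chartDeriv (p : M) (y : E2) : E2 →L[ℝ] E2 :=
  mfderiv 𝓘(ℝ, E2) 𝓘(ℝ, E2) (chartAt E2 p).symm y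

theorem mdifferentiable_chartAt (p : M) :
    (chartAt E2 p).MDifferentiable 𝓘(ℝ, E2) 𝓘(ℝ, E2) :=
  haveI : IsManifold 𝓘(ℝ, E2) 1 M := IsManifold.of_le (n := ∞) (by norm_cast)
  mdifferentiable_chart p

theorem chartDeriv_surjective {p : M} {y : E2} (hy : y ∈ (chartAt E2 p).target) :
    Function.Surjective (chartDeriv p y) :=
  (mdifferentiable_chartAt p).symm.mfderiv_surjective hy

theorem chartDeriv_injective {p : M} {y : E2} (hy : y ∈ (chartAt E2 p).target) :
    Function.Injective (chartDeriv p y) :=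
  (mdifferentiable_chartAt p).symm.mfderiv_injective hy

theorem fderiv_comp_chart_symm {F : M → E4} {p : M} {y : E2} (hy : y ∈ (chartAt E2 p).target)
    (hF : MDifferentiableAt 𝓘(ℝ, E2) 𝓘(ℝ, E4) F ((chartAt E2 p).symm y)) :
    fderiv ℝ (F ∘ (chartAt E2 p).symm) y =
      differential F ((chartAt E2 p).symm y) ∘L chartDeriv p y := by
  rw [← mfderiv_eq_fderiv]
  exact mfderiv_comp y hF ((mdifferentiable_chartAt p).mdifferentiableAt_symm hy)

theorem fderiv_scalar_comp_chart_symm {u : M → ℝ} {p : M} {y : E2}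
    (hy : y ∈ (chartAt E2 p).target)
    (hu : MDifferentiableAt 𝓘(ℝ, E2) 𝓘(ℝ, ℝ) u ((chartAt E2 p).symm y)) :
    fderiv ℝ (u ∘ (chartAt E2 p).symm) y =
      scalarDifferential u ((chartAt E2 p).symm y) ∘L chartDeriv p y := by
  rw [← mfderiv_eq_fderiv]
  exact mfderiv_comp y hu ((mdifferentiable_chartAt p).mdifferentiableAt_symm hy)

theorem contDiffAt_comp_chart_symm {E : Type*} [NormedAddCommGroup E] [NormedSpace ℝ E]
    {f : M → E} {p : M} {y : E2} (hy : y ∈ (chartAt E2 p).target)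
    (hf : ContMDiffAt 𝓘(ℝ, E2) 𝓘(ℝ, E) ∞ f ((chartAt E2 p).symm y)) :
    ContDiffAt ℝ ∞ (f ∘ (chartAt E2 p).symm) y :=
  contMDiffAt_iff_contDiffAt.1 (hf.comp y
    ((contMDiffOn_chart_symm (I := 𝓘(ℝ, E2))).contMDiffAt
      ((chartAt E2 p).open_target.mem_nhds hy)))

theorem IsSmoothImmersion.fderiv_comp_chart_symm {F : M → E4} (hF : IsSmoothImmersion F) {p : M}
    {y : E2} (hy : y ∈ (chartAt E2 p).target) :
    fderiv ℝ (F ∘ (chartAt E2 p).symm) y =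
      differential F ((chartAt E2 p).symm y) ∘L chartDeriv p y :=
  LagrangianShrinker.fderiv_comp_chart_symm hy (hF.mdifferentiableAt _)

theorem IsSmoothImmersion.injective_fderiv {F : M → E4} (hF : IsSmoothImmersion F) {p : M}
    {y : E2} (hy : y ∈ (chartAt E2 p).target) :
    Function.Injective (fderiv ℝ (F ∘ (chartAt E2 p).symm) y) := by
  rw [hF.fderiv_comp_chart_symm hy]
  exact (hF.2 _).comp (chartDeriv_injective hy)

end

/-! ### The reflection symmetry splits the surface -/

/-- `reflectX1` as a continuous linear map. -/
def reflectL : E4 →L[ℝ] E4 :=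
  LinearMap.toContinuousLinearMap
    { toFun := reflectX1
      map_add' := fun x y => by
        ext i; fin_cases i <;> simp [reflectX1]; ring
      map_smul' := fun c x => by
        ext i; fin_cases i <;> simp [reflectX1] }

theorem reflectL_apply (x : E4) : reflectL x = reflectX1 x := rfl

theorem kahlerForm_reflectL (v w : E4) :
    kahlerForm (reflectL v) (reflectL w) =
      -cross (fstL v) (fstL w) + cross (sndL v) (sndL w) := by
  simp [kahlerForm, reflectL_apply, reflectX1, cross, fstL_apply, sndL_apply, fstC, sndC]
  ring

/-- Near a point, an immersed surface is the fixed point set of a smooth map onto it. -/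
theorem exists_local_projection {X : E2 → E4} {x : E2} (hX : ContDiffAt ℝ ∞ X x)
    (hinj : Function.Injective (fderiv ℝ X x)) :
    ∃ T : E4 → E4, ∀ᶠ y in 𝓝 x, T (X y) = X y ∧ DifferentiableAt ℝ T (X y) ∧
      ∀ v, ∃ w, fderiv ℝ T (X y) v = fderiv ℝ X y w := by
  -- With `P` a linear left inverse of the differential at `x`, `P ∘ X` has derivative the identity
  -- there. The inverse function theorem supplies `G`, and the projection is `X ∘ G ∘ P`.
  obtain ⟨π, hπ⟩ := LinearMap.exists_leftInverse_of_injective (fderiv ℝ X x : E2 →ₗ[ℝ] E4)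
    (LinearMap.ker_eq_bot.2 hinj)
  set P : E4 →L[ℝ] E2 := LinearMap.toContinuousLinearMap π with hP
  have hf : ContDiffAt ℝ 1 (P ∘ X) x :=
    (P.contDiff.contDiffAt.comp x hX).of_le (by norm_cast)
  have hf' : HasFDerivAt (P ∘ X) ((ContinuousLinearEquiv.refl ℝ E2 : E2 ≃L[ℝ] E2) : E2 →L[ℝ] E2)
      x := by
    refine (P.hasFDerivAt.comp x (hX.differentiableAt (by simp)).hasFDerivAt).congr_fderiv ?_
    ext1 v
    exact LinearMap.congr_fun hπ v
  set G := hf.localInverse hf' one_ne_zero with hG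
  have hGd : ∀ᶠ y in 𝓝 x, DifferentiableAt ℝ G (P (X y)) := by
    have h1 : ∀ᶠ z in 𝓝 ((P ∘ X) x), ContDiffAt ℝ 1 G z :=
      (hf.to_localInverse hf' one_ne_zero).eventually (by simp)
    filter_upwards [hf.continuousAt.eventually h1] with y hy
    exact hy.differentiableAt (by simp)
  have hGl : ∀ᶠ y in 𝓝 x, G (P (X y)) = y :=
    (hf.hasStrictFDerivAt' hf' one_ne_zero).eventually_left_inverse
  have hXd : ∀ᶠ y in 𝓝 x, DifferentiableAt ℝ X y := by
    filter_upwards [(hX.of_le (m := 1) (by norm_cast)).eventually (by simp)] with y hy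
    exact hy.differentiableAt (by simp)
  refine ⟨fun z => X (G (P z)), ?_⟩
  filter_upwards [hGd, hGl, hXd] with y hy1 hy2 hy3
  have hd : HasFDerivAt (fun z => X (G (P z)))
      (fderiv ℝ X y ∘L (fderiv ℝ G (P (X y)) ∘L P)) (X y) := by
    have h3 := hy3.hasFDerivAt
    rw [← hy2] at h3
    have h4 := hy1.hasFDerivAt.comp (X y) P.hasFDerivAt
    have h5 := HasFDerivAt.comp (X y) (g := X) (f := G ∘ P) h3 h4
    rwa [hy2] at h5
  refine ⟨by simp only [hy2], hd.differentiableAt, fun v => ⟨fderiv ℝ G (P (X y)) (P v), ?_⟩⟩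
  rw [hd.fderiv]
  rfl

section

variable {M : Type*} [TopologicalSpace M] [ChartedSpace E2 M] [IsManifold 𝓘(ℝ, E2) ∞ M]
  {F : M → E4}

theorem IsSmoothImmersion.exists_local_projection (hF : IsSmoothImmersion F) (p : M) :
    ∃ T : E4 → E4, ∀ᶠ q in 𝓝 p, T (F q) = F q ∧ DifferentiableAt ℝ T (F q) ∧
      ∀ v, ∃ w, fderiv ℝ T (F q) v = differential F q w := by
  set φ := chartAt E2 p with hφ
  have hp : p ∈ φ.source := mem_chart_source E2 p
  have hy := φ.map_source hp
  obtain ⟨T, hT⟩ := LagrangianShrinker.exists_local_projection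
    (contDiffAt_comp_chart_symm hy (hF.1 _)) (hF.injective_fderiv hy)
  refine ⟨T, ?_⟩
  filter_upwards [(φ.continuousAt hp).eventually hT, φ.open_source.mem_nhds hp] with q hq hqs
  rw [Function.comp_apply, φ.left_inv hqs] at hq
  refine ⟨hq.1, hq.2.1, fun v => ?_⟩
  obtain ⟨w, hw⟩ := hq.2.2 v
  refine ⟨chartDeriv p (φ q) w, ?_⟩
  rw [hw, hF.fderiv_comp_chart_symm (φ.map_source hqs)]
  change differential F (φ.symm (φ q)) _ = _
  rw [φ.left_inv hqs]
  rfl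

/-- If a bilinear condition on the differential holds on a dense set, it holds everywhere. -/
theorem IsSmoothImmersion.cross_eq_zero_of_dense (hF : IsSmoothImmersion F) (a : E4 →L[ℝ] ℂ)
    {s : Set M} (hs : Dense s)
    (h : ∀ p ∈ s, ∀ v w, cross (a (differential F p v)) (a (differential F p w)) = 0) (p : M)
    (v w : E2) : cross (a (differential F p v)) (a (differential F p w)) = 0 := by
  set φ := chartAt E2 p with hφ
  have hp : p ∈ φ.source := mem_chart_source E2 p
  have hy := φ.map_source hp
  obtain ⟨v, rfl⟩ := chartDeriv_surjective hy v
  obtain ⟨w, rfl⟩ := chartDeriv_surjective hy w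
  set X := F ∘ φ.symm with hX
  have hXd : ∀ q ∈ φ.source, fderiv ℝ X (φ q) = differential F q ∘L chartDeriv p (φ q) := by
    intro q hq
    rw [hX, hF.fderiv_comp_chart_symm (φ.map_source hq), ← hφ, φ.left_inv hq]
  have hc : ∀ u, ContinuousAt (fun y => a (fderiv ℝ X y u)) (φ p) := fun u =>
    (hasFDerivAt_clm_fderiv_apply (contDiffAt_comp_chart_symm hy (hF.1 _)) u).continuousAt
  have hcr : ContinuousAt (fun q => cross (a (fderiv ℝ X (φ q) v)) (a (fderiv ℝ X (φ q) w))) p := by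
    have h1 : ContinuousAt (fun y => cross (a (fderiv ℝ X y v)) (a (fderiv ℝ X y w))) (φ p) := by
      unfold cross
      have hre : ∀ u, ContinuousAt (fun y => (a (fderiv ℝ X y u)).re) (φ p) := fun u =>
        Complex.continuous_re.continuousAt.comp (hc u)
      have him : ∀ u, ContinuousAt (fun y => (a (fderiv ℝ X y u)).im) (φ p) := fun u =>
        Complex.continuous_im.continuousAt.comp (hc u)
      exact ((hre v).mul (him w)).sub ((him v).mul (hre w))
    exact ContinuousAt.comp (f := φ) h1 (φ.continuousAt hp)
  by_contra hne
  have hne' : cross (a (fderiv ℝ X (φ p) v)) (a (fderiv ℝ X (φ p) w)) ≠ 0 := by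
    rw [hXd p hp]; exact hne
  obtain ⟨q, hq, hqs⟩ := hs.inter_nhds_nonempty
    ((hcr.eventually_ne hne').and (φ.open_source.mem_nhds hp))
  apply hqs.1
  rw [hXd q hqs.2]
  exact h q hq _ _

/-- For a symmetric Lagrangian surface both factors of the differential have rank at most one. -/
theorem cross_eq_zero_of_symmetric [T2Space M] [CompactSpace M] (hF : IsSmoothImmersion F)
    (hL : IsLagrangian F) (hsym : IsSymmetricX1 F) (p : M) (v w : E2) :
    cross (fstL (differential F p v)) (fstL (differential F p w)) = 0 ∧
      cross (sndL (differential F p v)) (sndL (differential F p w)) = 0 := by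
  have hFc : Continuous F := hF.1.continuous
  choose T hT using hF.exists_local_projection
  choose V hVn hVT hVc using fun p => LocallyCompactSpace.local_compact_nhds p _ (hT p)
  obtain ⟨t, ht⟩ := CompactSpace.elim_nhds_subcover V hVn
  -- The points whose mirror image lies on the compact piece `F '' V i`. By symmetry these finitely
  -- many closed sets cover `M`, so by Baire their interiors have dense union.
  let K : t → Set M := fun i => (fun q => reflectL (F q)) ⁻¹' (F '' V i)
  have hKc : ∀ i, IsClosed (K i) := fun i =>
    ((hVc i).image hFc).isClosed.preimage (reflectL.continuous.comp hFc)
  have hKu : ⋃ i, K i = Set.univ := by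
    rw [Set.eq_univ_iff_forall]
    intro q
    have hq : reflectL (F q) ∈ Set.range F := by
      rw [← hsym]
      exact ⟨F q, ⟨q, rfl⟩, rfl⟩
    obtain ⟨q', hq'⟩ := hq
    have hmem : q' ∈ ⋃ x ∈ t, V x := by rw [ht]; trivial
    simp only [Set.mem_iUnion] at hmem ⊢
    obtain ⟨x, hx, hxV⟩ := hmem
    exact ⟨⟨x, hx⟩, q', hxV, hq'⟩
  have hdense := dense_iUnion_interior_of_closed hKc hKu
  have hzero : ∀ q ∈ ⋃ i, interior (K i), ∀ v w,
      kahlerForm (reflectL (differential F q v)) (reflectL (differential F q w)) = 0 := by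
    intro q hq v w
    simp only [Set.mem_iUnion] at hq
    obtain ⟨i, hi⟩ := hq
    -- On the interior of `K i` the reflected surface is fixed by `T i`. Differentiating puts its
    -- tangent vectors in the range of the derivative of `T i`, hence in the tangent plane at `q'`,
    -- which is Lagrangian.
    have hev : (fun r => T i (reflectL (F r))) =ᶠ[𝓝 q] fun r => reflectL (F r) := by
      filter_upwards [mem_interior_iff_mem_nhds.1 hi] with r hr
      obtain ⟨r', hr', hrr⟩ := hr
      simp only [← hrr]
      exact (hVT _ hr').1
    obtain ⟨q', hq', hqq⟩ := interior_subset hi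
    obtain ⟨-, hTd, hTr⟩ := hVT _ hq'
    have hqq : F q' = reflectL (F q) := hqq
    have hRd := reflectL.differentiableAt.mdifferentiableAt.comp q (hF.mdifferentiableAt q)
    have hcomp : differential (fun r => T i (reflectL (F r))) q =
        fderiv ℝ (T i) (F q') ∘L differential (fun r => reflectL (F r)) q := by
      rw [hqq] at hTd ⊢
      rw [← mfderiv_eq_fderiv]
      exact mfderiv_comp q hTd.mdifferentiableAt hRd
    have heq : differential (fun r => T i (reflectL (F r))) q =
        differential (fun r => reflectL (F r)) q := hev.mfderiv_eq
    have hmem : ∀ u, ∃ u', reflectL (differential F q u) = differential F q' u' := fun u => by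
      obtain ⟨u', hu'⟩ := hTr (differential (fun r => reflectL (F r)) q u)
      refine ⟨u', ?_⟩
      rw [← hu']
      exact (DFunLike.congr_fun (hcomp.symm.trans
        (heq.trans (differential_clm_comp reflectL (hF.mdifferentiableAt q)))) u).symm
    obtain ⟨v', hv'⟩ := hmem v
    obtain ⟨w', hw'⟩ := hmem w
    rw [hv', hw']
    exact hL q' v' w'
  refine ⟨hF.cross_eq_zero_of_dense fstL hdense (fun q hq v w => ?_) p v w,
    hF.cross_eq_zero_of_dense sndL hdense (fun q hq v w => ?_) p v w⟩
  -- The sum and the difference of the two area forms vanish, so each does.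
  all_goals
    have h1 := hzero q hq v w
    have h2 := hL q v w
    rw [kahlerForm_reflectL] at h1
    rw [kahlerForm_eq] at h2
    linarith

end

/-! ### Polar representations -/

theorem exists_isPolarAngleNear {M : Type*} [TopologicalSpace M] [ChartedSpace E2 M]
    {f : M → ℂ} {p : M} (hf : ContMDiffAt 𝓘(ℝ, E2) 𝓘(ℝ, ℂ) ∞ f p) (h0 : f p ≠ 0) :
    ∃ θ, IsPolarAngleNear f θ p := by
  have hslit : f p / f p ∈ Complex.slitPlane := by rw [div_self h0]; exact Complex.one_mem_slitPlane
  -- Dividing by `f p` moves the base value to 1, away from the cut of the logarithm.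
  let g : ℂ → ℝ := fun z => (Complex.log (z / f p)).im + (f p).arg
  have hg : ContDiffAt ℝ ∞ g (f p) := by
    have h1 : ContDiffAt ℝ ∞ (fun z : ℂ => z / f p) (f p) := contDiffAt_id.div_const _
    have h2 : ContDiffAt ℝ ∞ Complex.log (f p / f p) :=
      (Complex.contDiffAt_log hslit).restrict_scalars ℝ
    have h3 : ContDiffAt ℝ ∞ (fun z : ℂ => Complex.log (z / f p)) (f p) :=
      ContDiffAt.comp (f p) (g := Complex.log) h2 h1
    exact (Complex.imCLM.contDiff.contDiffAt.comp _ h3).add contDiffAt_const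
  refine ⟨fun q => g (f q), hg.contMDiffAt.comp p hf, ?_⟩
  filter_upwards [hf.continuousAt.eventually_ne h0] with q hq
  have h1 : (f q : ℂ) = ‖f q‖ * Complex.exp (((f q / f p).arg + (f p).arg : ℝ) * Complex.I) := by
    have e1 := Complex.norm_mul_exp_arg_mul_I (f q / f p)
    have e2 := Complex.norm_mul_exp_arg_mul_I (f p)
    have hn : (‖f p‖ : ℂ) ≠ 0 := by simpa using h0
    have e3 : f q = ((‖f q / f p‖ : ℂ) * Complex.exp ((f q / f p).arg * Complex.I)) *
        (‖f p‖ * Complex.exp ((f p).arg * Complex.I)) := by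
      rw [e1, e2, div_mul_cancel₀ _ h0]
    refine e3.trans ?_
    rw [norm_div]
    push_cast
    rw [add_mul, Complex.exp_add]
    field_simp
  simpa only [g, Complex.log_im] using h1

/-- The derivative of an angle function: `z × dz = r² dθ`. -/
theorem cross_fderiv_of_polar {Z : E2 → ℂ} {θ : E2 → ℝ} {y : E2} {Z' : E2 →L[ℝ] ℂ}
    {θ' : E2 →L[ℝ] ℝ} (hZ : HasFDerivAt Z Z' y) (hθ : HasFDerivAt θ θ' y) (h0 : Z y ≠ 0)
    (h : ∀ᶠ x in 𝓝 y, Z x = (‖Z x‖ : ℂ) * Complex.exp ((θ x : ℂ) * Complex.I)) (v : E2) :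
    cross (Z y) (Z' v) = Complex.normSq (Z y) * θ' v := by
  have hr : HasFDerivAt (fun x => ‖Z x‖) (fderiv ℝ (fun x => ‖Z x‖) y) y :=
    (hZ.differentiableAt.norm ℝ h0).hasFDerivAt
  set r' := fderiv ℝ (fun x => ‖Z x‖) y
  have hre : HasFDerivAt (fun x => (Z x).re) (‖Z y‖ • (-Real.sin (θ y) • θ') +
      Real.cos (θ y) • r') y := by
    refine (hr.mul hθ.cos).congr_of_eventuallyEq ?_
    filter_upwards [h] with x hx
    rw [hx]
    simp [Complex.exp_re, Complex.exp_im]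
  have him : HasFDerivAt (fun x => (Z x).im) (‖Z y‖ • (Real.cos (θ y) • θ') +
      Real.sin (θ y) • r') y := by
    refine (hr.mul hθ.sin).congr_of_eventuallyEq ?_
    filter_upwards [h] with x hx
    rw [hx]
    simp [Complex.exp_re, Complex.exp_im]
  have h1 := DFunLike.congr_fun (hre.unique (Complex.reCLM.hasFDerivAt.comp y hZ)) v
  have h2 := DFunLike.congr_fun (him.unique (Complex.imCLM.hasFDerivAt.comp y hZ)) v
  have hy := h.self_of_nhds
  have h3 : (Z y).re = ‖Z y‖ * Real.cos (θ y) := by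
    conv_lhs => rw [hy]
    simp [Complex.exp_re, Complex.exp_im]
  have h4 : (Z y).im = ‖Z y‖ * Real.sin (θ y) := by
    conv_lhs => rw [hy]
    simp [Complex.exp_re, Complex.exp_im]
  simp at h1 h2
  rw [Complex.normSq_eq_norm_sq, cross, ← h1, ← h2, h3, h4]
  linear_combination ‖Z y‖ ^ 2 * θ' v * Real.sin_sq_add_cos_sq (θ y)

/-! ### The global first integral -/

section

variable {M : Type*} [TopologicalSpace M] [ChartedSpace E2 M] [IsManifold 𝓘(ℝ, E2) ∞ M]
  {F : M → E4} {a b : E4 →L[ℝ] ℂ}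

/-- The first integral of the curve factor `a ∘ F` of a split self-shrinker. -/
def firstIntegral (F : M → E4) (a : E4 →L[ℝ] ℂ) (p : M) : ℝ :=
  crossQuotient (a (F p)) (a ∘L differential F p) * Real.exp (-Complex.normSq (a (F p)))

theorem isLocallyConstant_firstIntegral (hs : IsSplitting a b) (hF : IsLagrangianSelfShrinker F)
    (ha : ∀ p v w, cross (a (differential F p v)) (a (differential F p w)) = 0)
    (hb : ∀ p v w, cross (b (differential F p v)) (b (differential F p w)) = 0) :
    IsLocallyConstant (firstIntegral F a) := by
  rw [IsLocallyConstant.iff_eventually_eq]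
  intro p
  have hFi := hF.immersion
  set φ := chartAt E2 p with hφ
  have hp : p ∈ φ.source := mem_chart_source E2 p
  have hy := φ.map_source hp
  set X := F ∘ φ.symm with hX
  set ψ : E2 → ℝ := fun y => crossQuotient (a (X y)) (a ∘L fderiv ℝ X y) *
    Real.exp (-Complex.normSq (a (X y))) with hψ
  have hdX : ∀ y ∈ φ.target, fderiv ℝ X y = differential F (φ.symm y) ∘L chartDeriv p y :=
    fun y hy => hFi.fderiv_comp_chart_symm hy
  have haX : ∀ y ∈ φ.target, ∀ v w, cross (a (fderiv ℝ X y v)) (a (fderiv ℝ X y w)) = 0 := by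
    intro y hy v w
    rw [hdX y hy]
    exact ha _ _ _
  have hbX : ∀ y ∈ φ.target, ∀ v w, cross (b (fderiv ℝ X y v)) (b (fderiv ℝ X y w)) = 0 := by
    intro y hy v w
    rw [hdX y hy]
    exact hb _ _ _
  have hψΨ : ∀ y ∈ φ.target, ψ y = firstIntegral F a (φ.symm y) := by
    intro y hy
    obtain ⟨e, -, he⟩ := hs.exists_kernel_vector (hFi.2 (φ.symm y)) (hb _)
    simp only [hψ, firstIntegral, hdX y hy]
    rw [← ContinuousLinearMap.comp_assoc,
      crossQuotient_comp _ (L := a ∘L differential F (φ.symm y)) (ha _) ⟨e, he⟩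
        (chartDeriv_surjective hy)]
    rfl
  have hder : ∀ y ∈ φ.target, HasFDerivAt ψ (0 : E2 →L[ℝ] ℝ) y := fun y hy =>
    hasFDerivAt_firstIntegral hs (contDiffAt_comp_chart_symm hy (hFi.1 _))
      (hFi.injective_fderiv hy)
      (by filter_upwards [φ.open_target.mem_nhds hy] with z hz using haX z hz)
      (hbX y hy) (hF.shrinker φ (chart_mem_atlas E2 p) y hy)
  obtain ⟨ε, hε, hball⟩ := Metric.isOpen_iff.1 φ.open_target _ hy
  filter_upwards [φ.open_source.mem_nhds hp,
    (φ.continuousAt hp).preimage_mem_nhds (Metric.ball_mem_nhds (φ p) hε)] with q hq hqb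
  have h := Metric.isOpen_ball.is_const_of_fderiv_eq_zero
    (convex_ball (φ p) ε).isPreconnected
    (fun y hy => (hder y (hball hy)).differentiableAt.differentiableWithinAt)
    (fun y hy => (hder y (hball hy)).fderiv) hqb (Metric.mem_ball_self hε)
  rw [hψΨ _ (hball hqb), hψΨ _ hy, φ.left_inv hq, φ.left_inv hp] at h
  exact h

/-- Constancy of the first integral, with denominators cleared so that `v` may lie in the kernel.
The sign of `C` is still open: a line through the origin would give zero. -/
theorem exists_cross_sq_eq [ConnectedSpace M] (hs : IsSplitting a b)
    (hF : IsLagrangianSelfShrinker F)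
    (ha : ∀ p v w, cross (a (differential F p v)) (a (differential F p w)) = 0)
    (hb : ∀ p v w, cross (b (differential F p v)) (b (differential F p w)) = 0) :
    ∃ C : ℝ, ∀ p v, cross (a (F p)) (a (differential F p v)) ^ 2 =
      C * Real.exp (Complex.normSq (a (F p))) * Complex.normSq (a (differential F p v)) := by
  have hconst := isLocallyConstant_firstIntegral hs hF ha hb
  obtain ⟨p₀⟩ := (inferInstance : Nonempty M)
  refine ⟨firstIntegral F a p₀, fun p v => ?_⟩
  by_cases hv : a (differential F p v) = 0
  · simp [hv, cross]
  have hn : Complex.normSq (a (differential F p v)) ≠ 0 := by simpa using hv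
  rw [hconst.apply_eq_of_preconnectedSpace p₀ p, firstIntegral,
    crossQuotient_eq _ (L := a ∘L differential F p) (ha p) hv, mul_assoc (_ / _), ← Real.exp_add,
    neg_add_cancel, Real.exp_zero, mul_one, ContinuousLinearMap.comp_apply, div_mul_cancel₀ _ hn]

theorem dot_eq_zero_of_isMax (hF : IsSmoothImmersion F) {p : M}
    (hmax : ∀ q, Complex.normSq (a (F q)) ≤ Complex.normSq (a (F p))) (v : E2) :
    dot (a (F p)) (a (differential F p v)) = 0 := by
  set φ := chartAt E2 p with hφ
  have hp : p ∈ φ.source := mem_chart_source E2 p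
  have hy := φ.map_source hp
  obtain ⟨v, rfl⟩ := chartDeriv_surjective hy v
  have hX := contDiffAt_comp_chart_symm hy (hF.1 _)
  have hZ : HasFDerivAt (fun y => a ((F ∘ φ.symm) y)) (a ∘L fderiv ℝ (F ∘ φ.symm) (φ p)) (φ p) :=
    a.hasFDerivAt.comp _ (hX.differentiableAt (by simp)).hasFDerivAt
  have hm : IsLocalMax (fun y => Complex.normSq (a ((F ∘ φ.symm) y))) (φ p) := by
    refine Filter.Eventually.of_forall fun y => ?_
    simp only [Function.comp_apply, φ.left_inv hp]
    exact hmax _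
  have h := fderiv_normSq_comp hZ.differentiableAt v
  rw [hm.fderiv_eq_zero, hZ.fderiv, hF.fderiv_comp_chart_symm hy] at h
  simp only [ContinuousLinearMap.comp_apply, Function.comp_apply, ← hφ, φ.left_inv hp] at h
  simpa using h.symm

theorem clm_differential_eq_zero (hF : IsSmoothImmersion F) (h : ∀ q, a (F q) = 0) (p : M)
    (v : E2) : a (differential F p v) = 0 := by
  set φ := chartAt E2 p with hφ
  have hp : p ∈ φ.source := mem_chart_source E2 p
  have hy := φ.map_source hp
  obtain ⟨v, rfl⟩ := chartDeriv_surjective hy v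
  have hX := contDiffAt_comp_chart_symm hy (hF.1 _)
  have hZ : HasFDerivAt (fun y => a ((F ∘ φ.symm) y)) (a ∘L fderiv ℝ (F ∘ φ.symm) (φ p)) (φ p) :=
    a.hasFDerivAt.comp _ (hX.differentiableAt (by simp)).hasFDerivAt
  have h0 : (fun y => a ((F ∘ φ.symm) y)) = fun _ => 0 := funext fun y => h _
  rw [h0, hF.fderiv_comp_chart_symm hy] at hZ
  have h1 := DFunLike.congr_fun (hZ.unique (hasFDerivAt_const 0 _)) v
  simpa only [ContinuousLinearMap.comp_apply, ← hφ, φ.left_inv hp,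
    zero_apply] using h1

/-- At a maximum of |a ∘ F| position and tangent of the curve factor are orthogonal, so `C ≤ 0`
would force `a ∘ F` to vanish identically, and its differential with it. -/
theorem exists_pos_cross_sq_eq [CompactSpace M] [ConnectedSpace M] (hs : IsSplitting a b)
    (hF : IsLagrangianSelfShrinker F)
    (ha : ∀ p v w, cross (a (differential F p v)) (a (differential F p w)) = 0)
    (hb : ∀ p v w, cross (b (differential F p v)) (b (differential F p w)) = 0) :
    ∃ C : ℝ, 0 < C ∧ ∀ p v, cross (a (F p)) (a (differential F p v)) ^ 2 =
      C * Real.exp (Complex.normSq (a (F p))) * Complex.normSq (a (differential F p v)) := by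
  obtain ⟨C, hC⟩ := exists_cross_sq_eq hs hF ha hb
  refine ⟨C, ?_, hC⟩
  have hcont : Continuous fun q => Complex.normSq (a (F q)) :=
    Complex.continuous_normSq.comp (a.continuous.comp hF.immersion.1.continuous)
  obtain ⟨p, -, hp⟩ := isCompact_univ.exists_isMaxOn Set.univ_nonempty hcont.continuousOn
  have hmax : ∀ q, Complex.normSq (a (F q)) ≤ Complex.normSq (a (F p)) := fun q =>
    hp (Set.mem_univ q)
  obtain ⟨e, -, he⟩ := hs.exists_kernel_vector (hF.immersion.2 p) (hb p)
  have hn : 0 < Complex.normSq (a (differential F p e)) := Complex.normSq_pos.2 he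
  by_contra hCpos
  have hle : cross (a (F p)) (a (differential F p e)) ^ 2 ≤ 0 := by
    rw [hC, mul_assoc]
    exact mul_nonpos_of_nonpos_of_nonneg (not_lt.1 hCpos) (by positivity)
  have h1 := normSq_mul_normSq (a (F p)) (a (differential F p e))
  rw [dot_eq_zero_of_isMax hF.immersion hmax] at h1
  have h2 : Complex.normSq (a (F p)) ≤ 0 := by
    by_contra h3
    have := mul_pos (not_le.1 h3) hn
    linarith
  exact he (clm_differential_eq_zero hF.immersion (fun q => Complex.normSq_eq_zero.1
    (le_antisymm ((hmax q).trans h2) (Complex.normSq_nonneg _))) p e)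

theorem cross_differential_of_polar (hF : IsSmoothImmersion F) {p : M} {θ : M → ℝ}
    (h0 : a (F p) ≠ 0) (hθ : IsPolarAngleNear (fun q => a (F q)) θ p) (v : E2) :
    cross (a (F p)) (a (differential F p v)) =
      Complex.normSq (a (F p)) * scalarDifferential θ p v := by
  set φ := chartAt E2 p with hφ
  have hp : p ∈ φ.source := mem_chart_source E2 p
  have hy := φ.map_source hp
  obtain ⟨v, rfl⟩ := chartDeriv_surjective hy v
  have hX := contDiffAt_comp_chart_symm hy (hF.1 _)
  have hZ : HasFDerivAt (fun y => a ((F ∘ φ.symm) y)) (a ∘L fderiv ℝ (F ∘ φ.symm) (φ p)) (φ p) :=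
    a.hasFDerivAt.comp _ (hX.differentiableAt (by simp)).hasFDerivAt
  have hθ1 : ContMDiffAt 𝓘(ℝ, E2) 𝓘(ℝ, ℝ) ∞ θ (φ.symm (φ p)) := by
    rw [φ.left_inv hp]; exact hθ.1
  have hθ2 := ((contDiffAt_comp_chart_symm hy hθ1).differentiableAt (by simp)).hasFDerivAt
  have hev : ∀ᶠ y in 𝓝 (φ p), a ((F ∘ φ.symm) y) =
      (‖a ((F ∘ φ.symm) y)‖ : ℂ) * Complex.exp (((θ ∘ φ.symm) y : ℂ) * Complex.I) := by
    have ht := φ.continuousAt_symm hy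
    rw [ContinuousAt, φ.left_inv hp] at ht
    exact ht.eventually hθ.2
  have h := cross_fderiv_of_polar hZ hθ2
    (by simpa only [Function.comp_apply, φ.left_inv hp] using h0) hev v
  rw [hF.fderiv_comp_chart_symm hy,
    fderiv_scalar_comp_chart_symm hy (hθ1.mdifferentiableAt (by simp))] at h
  simpa only [ContinuousLinearMap.comp_apply, Function.comp_apply, ← hφ, φ.left_inv hp] using h

/-- Only the `a` component of ∇θ matters: it is `c` times T = `a (D e)`, with c|T|² = dθ(e) by
duality, while r² dθ = A × dA evaluates dθ on both ∇θ and `e`. -/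
theorem norm_pow_mul_gradNormSq (hs : IsSplitting a b) (hF : IsSmoothImmersion F)
    (ha : ∀ p v w, cross (a (differential F p v)) (a (differential F p w)) = 0)
    (hb : ∀ p v w, cross (b (differential F p v)) (b (differential F p w)) = 0) {C : ℝ}
    (hC : ∀ p v, cross (a (F p)) (a (differential F p v)) ^ 2 =
      C * Real.exp (Complex.normSq (a (F p))) * Complex.normSq (a (differential F p v)))
    {p : M} (h0 : a (F p) ≠ 0) {θ : M → ℝ} (hθ : IsPolarAngleNear (fun q => a (F q)) θ p) :
    ‖a (F p)‖ ^ 4 * gradNormSq F θ p = C * Real.exp (‖a (F p)‖ ^ 2) := by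
  obtain ⟨e, hbe, he⟩ := hs.exists_kernel_vector (hF.2 p) (hb p)
  set V := gradient F θ p
  set D := differential F p
  set r2 := Complex.normSq (a (F p)) with hr2
  have hn : Complex.normSq (a (D e)) ≠ 0 := by simpa using he
  have hr0 : r2 ≠ 0 := by simpa [hr2] using h0
  have hVV : gradNormSq F θ p = scalarDifferential θ p V := inducedMetric_gradient F θ p (hF.2 p) V
  have hVe : inducedMetric F p V e = scalarDifferential θ p e :=
    inducedMetric_gradient F θ p (hF.2 p) e
  have hpV := cross_differential_of_polar hF h0 hθ V
  have hpe := cross_differential_of_polar hF h0 hθ e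
  have hVsmul := eq_smul_of_cross_eq_zero he (ha p V e)
  set c := dot (a (D e)) (a (D V)) / Complex.normSq (a (D e))
  change cross (a (F p)) (a (D V)) = _ at hpV
  rw [hVsmul, cross_smul_right, ← hr2] at hpV
  have hce : c * Complex.normSq (a (D e)) = scalarDifferential θ p e := by
    rw [← hVe, inducedMetric, real_inner_comm, hs.inner_eq]
    change _ = dot (a (D e)) (a (D V)) + dot (b (D e)) (b (D V))
    rw [hbe, hVsmul, dot_smul_right, dot_self]
    simp [dot]
  have hCe := hC p e
  have h4 : ‖a (F p)‖ ^ 4 = r2 ^ 2 := by rw [hr2, Complex.normSq_eq_norm_sq]; ring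
  rw [h4, hVV, ← Complex.normSq_eq_norm_sq, ← hr2]
  apply mul_right_cancel₀ hn
  rw [← hr2] at hCe hpe
  change cross (a (F p)) (a (D e)) ^ 2 = _ * Complex.normSq (a (D e)) at hCe
  change cross (a (F p)) (a (D e)) = _ at hpe
  rw [← hCe]
  linear_combination (-r2 * Complex.normSq (a (D e))) * hpV +
    (r2 * cross (a (F p)) (a (D e))) * hce - cross (a (F p)) (a (D e)) * hpe

theorem exists_polarRelation [CompactSpace M] [ConnectedSpace M] (hs : IsSplitting a b)
    (hF : IsLagrangianSelfShrinker F)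
    (ha : ∀ p v w, cross (a (differential F p v)) (a (differential F p w)) = 0)
    (hb : ∀ p v w, cross (b (differential F p v)) (b (differential F p w)) = 0) :
    (∀ p, 0 < ‖a (F p)‖) ∧ ∃ C : ℝ, 0 < C ∧ PolarRelation F (fun p => a (F p)) C := by
  obtain ⟨C, hC0, hC⟩ := exists_pos_cross_sq_eq hs hF ha hb
  -- Positivity of `C` makes A × T nonzero, so the curve factor avoids the origin.
  have hne : ∀ p, a (F p) ≠ 0 := fun p hp => by
    obtain ⟨e, -, he⟩ := hs.exists_kernel_vector (hF.immersion.2 p) (hb p)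
    have h1 := hC p e
    have h2 : 0 < Complex.normSq (a (differential F p e)) := Complex.normSq_pos.2 he
    have h3 : 0 < C * Real.exp (Complex.normSq (a (F p))) *
      Complex.normSq (a (differential F p e)) := by positivity
    rw [← h1, hp] at h3
    simp [cross] at h3
  exact ⟨fun p => norm_pos_iff.2 (hne p), C, hC0, fun p =>
    ⟨exists_isPolarAngleNear (a.contDiff.contMDiff.contMDiffAt.comp p (hF.immersion.1 p)) (hne p),
      fun θ hθ => norm_pow_mul_gradNormSq hs hF.immersion ha hb hC (hne p) hθ⟩⟩

end

end

end LagrangianShrinker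

open LagrangianShrinker in
theorem proposition4p3 {M : Type*} [TopologicalSpace M] [T2Space M] [CompactSpace M]
    [ConnectedSpace M] [ChartedSpace E2 M] [IsManifold 𝓘(ℝ, E2) ∞ M]
    (F : M → E4) (hF : IsLagrangianSelfShrinker F) (hsym : IsSymmetricX1 F) :
    (∀ p, 0 < ‖fstC (F p)‖) ∧ (∀ p, 0 < ‖sndC (F p)‖) ∧
    ∃ C₁ C₂ : ℝ, 0 < C₁ ∧ 0 < C₂ ∧
      PolarRelation F (fun p => fstC (F p)) C₁ ∧
      PolarRelation F (fun p => sndC (F p)) C₂ := by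
  have h := cross_eq_zero_of_symmetric hF.immersion hF.lagrangian hsym
  have h1 := fun p v w => (h p v w).1
  have h2 := fun p v w => (h p v w).2
  obtain ⟨hA, C₁, hC₁, hP₁⟩ := exists_polarRelation isSplitting_fstL_sndL hF h1 h2
  obtain ⟨hB, C₂, hC₂, hP₂⟩ := exists_polarRelation isSplitting_sndL_fstL hF h2 h1
  exact ⟨hA, hB, C₁, C₂, hC₁, hC₂, hP₁, hP₂⟩
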